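/- **Setting.** Let $M$ be a smooth $n$-manifold and $\mathcal T=LM\times_\rho V$ a vector or affine bundle associated to its frame bundle $LM$, where $\rho$ is a smooth action of $GL(n,\mathbb R)$ on a finite-dimensional real vector space $V$ by affine (e.g. linear) maps. Sections $\phi$ of $\mathcal T$ are identified with $\rho$-equivariant functions $\phi(x,e)\in V$ of a point $x\in M$ and a frame $e$ at $x$. The group $\mathrm{Diff}(M)$ acts on the right by pullback, $R_\psi\phi:=\psi^*\phi$, $(\psi^*\phi)(x,e)=\phi(\psi(x),d\psi_x\circ e)$; the same formula defines $\psi^*$ on all $V$-valued functions on $LM$. Curves $t\mapsto\phi_t\in\Gamma(\mathcal T)$ and $t\mapsto\psi_t\in\mathrm{Diff}(M)$ are smooth if they are jointly smooth on $\mathbb R\times M$. Let $\Phi\subset\Gamma(\mathcal T)$ be a $\mathrm{Diff}(M)$-invariant set of smooth sections (e.g. all of $\Gamma(\mathcal T)$) such that, for each $\phi\in\Phi$, the velocities at $\tau=0$ of smooth curves in $\Phi$ through $\phi$ form a vector space, denoted $T_\phi\Phi$. Maps from $\Phi$ to $\Phi$ or to $\mathrm{Diff}(M)$ are smooth if they send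 smooth curves to smooth curves. A vertical diffeomorphism is a diffeomorphism $\Xi$ of $\Phi$ with $\pi\circ\Xi=\pi$, where $\pi:\Phi\to\Phi/\mathrm{Diff}(M)$ is the projection. For a smooth curve $c$ in $\Phi$ with $c_0=\phi$ and $\mathfrak X=\tfrac{d}{d\tau}c_\tau|_{\tau=0}$ put $F_\star\mathfrak X=\tfrac{d}{d\tau}F(c_\tau)|_{\tau=0}$ for smooth $F:\Phi\to\Phi$, and $d\psi_\phi(\mathfrak X)=\tfrac{d}{d\tau}\psi(c_\tau)|_{\tau=0}\in T_{\psi(\phi)}\mathrm{Diff}(M)$ (a map $M\to TM$ covering $\psi(\phi)$) for smooth $\psi:\Phi\to\mathrm{Diff}(M)$. For a vector field $X=\tfrac{d}{d\tau}\eta_\tau|_{\tau=0}$ on $M$, with $\eta$ a smooth curve in $\mathrm{Diff}(M)$ and $\eta_0=\mathrm{id}$, put $X^v_{|\phi}=\tfrac{d}{d\tau}R_{\eta_\tau}\phi|_{\tau=0}\in T_\phi\Phi$. A $W$-valued $k$-form $\alpha$ on $\Phi$ assigns to each $\phi$ an alternating $k$-linear map $(T_\phi\Phi)^k\to W$, and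 $F^\star\alpha$ is its pullback. Let $\mathfrak L_X\phi$ be the Lie derivative, given in coordinates by $X^\mu\partial_\mu\phi-\rho_*(\partial X)\phi$, and let $d\phi$ be the tautological $1$-form on $\Phi$, $d\phi(\mathfrak X)=\mathfrak X$, valued in $V$-valued functions on $LM$. **Statement.** Let $\Xi$ be a vertical diffeomorphism of $\Phi$ with smooth generating map $\psi\in C^\infty(\Phi,\mathrm{Diff}(M))$, i.e. $\Xi(\phi)=\psi(\phi)^*\phi$ for all $\phi\in\Phi$. Then the following hold at each $\phi\in\Phi$, for tangent vectors $\mathfrak X,\mathfrak X_1,\dots,\mathfrak X_k\in T_\phi\Phi$ and any smooth curves representing them. 1. $\displaystyle \Xi_\star\mathfrak X = R_{\psi(\phi)\star}\mathfrak X+\big\{(\psi(\phi)^{-1})_*\,d\psi_\phi(\mathfrak X)\big\}^v_{|\Xi(\phi)} = R_{\psi(\phi)\star}\Big(\mathfrak X+\big\{d\psi_\phi(\mathfrak X)\circ\psi(\phi)^{-1}\big\}^v_{|\phi}\Big).$ 2. For every $k$-form $\alpha$ on $\Phi$, with values in any real vector space, the vertical transformation $\alpha^\psi:=\Xi^\star\alpha$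 is determined by the equivariance and verticality of $\alpha$: $$\alpha^\psi_{|\phi}(\mathfrak X_1,\dots,\mathfrak X_k)=\big(R^\star_{\psi(\phi)}\alpha\big)_{|\phi}\Big(\mathfrak X_1+\{d\psi_\phi(\mathfrak X_1)\circ\psi(\phi)^{-1}\}^v_{|\phi},\dots,\mathfrak X_k+\{d\psi_\phi(\mathfrak X_k)\circ\psi(\phi)^{-1}\}^v_{|\phi}\Big).$$ 3. Let $G$ be a group acting linearly on $W$ and $C:\Phi\times\mathrm{Diff}(M)\to G$ a $1$-cocycle, $C(\phi;\psi'\circ\psi)=C(\phi;\psi')\,C(\psi'^*\phi;\psi)$ (e.g. a representation of $\mathrm{Diff}(M)$). If a $W$-valued form $\alpha$ is $C$-tensorial, i.e. $R_\eta^\star\alpha_{|\eta^*\phi}=C(\phi;\eta)^{-1}\alpha_{|\phi}$ for all $\phi\in\Phi$ and $\eta\in\mathrm{Diff}(M)$, and $\iota_{X^v}\alpha=0$ for all $X$, then $\alpha^\psi_{|\phi}=C(\phi;\psi(\phi))^{-1}\alpha_{|\phi}$. 4. $d\phi^\psi=\psi^*\big(d\phi+\mathfrak L_{d\psi\circ\psi^{-1}}\phi\big)$,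 that is, $(\Xi^\star d\phi)_{|\phi}(\mathfrak X)=\psi(\phi)^*\big(d\phi(\mathfrak X)+\mathfrak L_{d\psi_\phi(\mathfrak X)\circ\psi(\phi)^{-1}}\phi\big)$. -/

import Mathlib

open scoped Manifold ContDiff Topology
open Bundle Set

set_option linter.unusedSectionVars false

noncomputable section

namespace FieldSpaceGeometry

/-- `Diff(M)`, the smooth diffeomorphisms of `M`. -/
abbrev Diff (E : Type*) [NormedAddCommGroup E] [NormedSpace ℝ E]
    (M : Type*) [TopologicalSpace M] [ChartedSpace E M] :=
  Diffeomorph 𝓘(ℝ, E) 𝓘(ℝ, E) M M ∞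

/-- The tangent bundle `TM`. -/
abbrev TM (E : Type*) [NormedAddCommGroup E] [NormedSpace ℝ E]
    (M : Type*) [TopologicalSpace M] [ChartedSpace E M] [IsManifold 𝓘(ℝ, E) ∞ M] :=
  TangentBundle 𝓘(ℝ, E) M

/-- The fibre over `x` of the frame bundle `LM`: a frame at `x` is a linear isomorphism from the
model space `E` (for instance `ℝⁿ`) onto `T_x M`. -/
abbrev Frame (E : Type*) [NormedAddCommGroup E] [NormedSpace ℝ E]
    {M : Type*} [TopologicalSpace M] [ChartedSpace E M] (x : M) :=
  E ≃L[ℝ] TangentSpace 𝓘(ℝ, E) x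

/-- `V`-valued functions on the frame bundle `LM`. Sections of bundles associated to `LM`,
and their variations, are such functions. -/
abbrev FrameFun (E V M : Type*) [NormedAddCommGroup E] [NormedSpace ℝ E]
    [TopologicalSpace M] [ChartedSpace E M] :=
  ∀ x : M, Frame E x → V

/-- The bundle type: a smooth left action `ρ` of the structure group `GL(E)` of `LM` on the
finite-dimensional vector space `V` by affine (in particular, by linear) maps. The bundle in
question is the affine or vector bundle `𝒯 = LM ×_ρ V` associated to `LM`. -/
structure FrameAction (E V : Type*) [NormedAddCommGroup E] [NormedSpace ℝ E] [CompleteSpace E]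
    [NormedAddCommGroup V] [NormedSpace ℝ V] where
  toHom : (E →L[ℝ] E)ˣ →* (V ≃ᵃ[ℝ] V)
  smooth : ContMDiff (𝓘(ℝ, E →L[ℝ] E).prod 𝓘(ℝ, V)) 𝓘(ℝ, V) ∞
    (fun q : (E →L[ℝ] E)ˣ × V => toHom q.1 q.2)

section

variable {E : Type*} [NormedAddCommGroup E] [NormedSpace ℝ E] [CompleteSpace E]
  {V : Type*} [NormedAddCommGroup V] [NormedSpace ℝ V]
  {M : Type*} [TopologicalSpace M] [ChartedSpace E M] [IsManifold 𝓘(ℝ, E) ∞ M]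

/-- The infinitesimal action `ρ_*(A) v` of `A ∈ gl(E)` at the point `v ∈ V`: the derivative at the
identity, in the direction `A`, of `g ↦ ρ(g) v`. -/
def FrameAction.inf (ρ : FrameAction E V) (A : E →L[ℝ] E) (v : V) : V :=
  (mfderiv 𝓘(ℝ, E →L[ℝ] E) 𝓘(ℝ, V) (fun g : (E →L[ℝ] E)ˣ => ρ.toHom g v) 1 :
    (E →L[ℝ] E) →L[ℝ] V) A

open Classical in
/-- The coordinate frame at `p` of the preferred chart around `x₀` (a junk value if `p` is not in
the domain of that chart). -/
def coordFrame (x₀ p : M) : Frame E p :=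
  if h : p ∈ (trivializationAt E (TangentSpace 𝓘(ℝ, E)) x₀).baseSet then
    ((trivializationAt E (TangentSpace 𝓘(ℝ, E)) x₀).continuousLinearEquivAt ℝ p h).symm
  else ContinuousLinearEquiv.refl ℝ E

theorem coordFrame_of_mem {x₀ p : M}
    (h : p ∈ (trivializationAt E (TangentSpace 𝓘(ℝ, E)) x₀).baseSet) :
    coordFrame x₀ p =
      ((trivializationAt E (TangentSpace 𝓘(ℝ, E)) x₀).continuousLinearEquivAt ℝ p h).symm :=
  dif_pos h

/-- The differential of a diffeomorphism at a point. -/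
def diffAt (η : Diff E M) (x : M) :
    TangentSpace 𝓘(ℝ, E) x ≃L[ℝ] TangentSpace 𝓘(ℝ, E) (η x) :=
  η.mfderivToContinuousLinearEquiv (by simp) x

/-- Pullback by `η`: `(η^* f)(x, e) = f(η(x), dη_x ∘ e)`. It is linear in `f`. For the functions on
`LM` that represent tensor fields this is the pullback of tensor fields. -/
def framePull (η : Diff E M) : FrameFun E V M →ₗ[ℝ] FrameFun E V M where
  toFun f := fun x e => f (η x) (e.trans (diffAt η x))
  map_add' _ _ := rfl
  map_smul' _ _ := rfl

/-- The elements of `Γ(𝒯)`, the smooth sections of the bundle `𝒯 = LM ×_ρ V`, given as the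
equivariant `V`-valued functions on `LM` whose components in coordinate frames are smooth. -/
@[ext]
structure Field (ρ : FrameAction E V) (M : Type*) [TopologicalSpace M] [ChartedSpace E M]
    [IsManifold 𝓘(ℝ, E) ∞ M] where
  toFun : FrameFun E V M
  equivariant : ∀ (x : M) (e : Frame E x) (g : (E →L[ℝ] E)ˣ),
    toFun x ((ContinuousLinearEquiv.unitsEquiv ℝ E g).trans e) = ρ.toHom g⁻¹ (toFun x e)
  smooth : ∀ x₀ : M, ContMDiffAt 𝓘(ℝ, E) 𝓘(ℝ, V) ∞ (fun p => toFun p (coordFrame x₀ p)) x₀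

/-- Smooth curves `t ↦ c_t` in the space of sections: the components in coordinate frames are
jointly smooth on `ℝ × M`. -/
def IsSmoothCurve {ρ : FrameAction E V} (c : ℝ → Field ρ M) : Prop :=
  ∀ (t₀ : ℝ) (x₀ : M), ContMDiffAt (𝓘(ℝ, ℝ).prod 𝓘(ℝ, E)) 𝓘(ℝ, V) ∞
    (fun q : ℝ × M => (c q.1).toFun q.2 (coordFrame x₀ q.2)) (t₀, x₀)

/-- The velocity `d/dt c_t |_{t = 0}`. -/
def velocity {ρ : FrameAction E V} (c : ℝ → Field ρ M) : FrameFun E V M :=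
  fun x e => deriv (fun t => (c t).toFun x e) 0

/-- Smooth curves `t ↦ η_t` in `Diff(M)`: jointly smooth on `ℝ × M`. -/
def IsSmoothDiffCurve (η : ℝ → Diff E M) : Prop :=
  ContMDiff (𝓘(ℝ, ℝ).prod 𝓘(ℝ, E)) 𝓘(ℝ, E) ∞ (fun q : ℝ × M => η q.1 q.2)

/-- The velocity `d/dt η_t |_{t = 0}` of a curve in `Diff(M)`: the element `x ↦ d/dt η_t(x)` of
`T_{η_0} Diff(M)`, a vector field along `η_0`, that is a map `M → TM` covering `η_0`. When `η_0`
is the identity, it is a vector field on `M`, an element of `diff(M) = Γ(TM)`. -/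
def diffVelocity (η : ℝ → Diff E M) : M → TM E M :=
  fun x => ⟨η 0 x, mfderiv 𝓘(ℝ, ℝ) 𝓘(ℝ, E) (fun t => η t x) 0 (1 : ℝ)⟩

theorem isSmoothCurve_const {ρ : FrameAction E V} (φ : Field ρ M) :
    IsSmoothCurve (fun _ : ℝ => φ) := fun t₀ x₀ =>
  (φ.smooth x₀).comp (t₀, x₀) contMDiffAt_snd

/-- The matrix of `d(η_t)_p` in the coordinate frames of the charts around `x₀` and `x₁`. -/
def frameChange (η : Diff E M) (x₀ x₁ p : M) : (E →L[ℝ] E)ˣ :=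
  (ContinuousLinearEquiv.unitsEquiv ℝ E).symm
    (((coordFrame x₀ p).trans (diffAt η p)).trans (coordFrame x₁ (η p)).symm)

theorem frameChange_trans (η : Diff E M) (x₀ x₁ p : M) :
    (ContinuousLinearEquiv.unitsEquiv ℝ E (frameChange η x₀ x₁ p)).trans (coordFrame x₁ (η p)) =
      (coordFrame x₀ p).trans (diffAt η p) := by
  ext v
  simp [frameChange]

theorem frameChange_smooth {η : ℝ → Diff E M} (hη : IsSmoothDiffCurve η) (t₀ : ℝ) (x₀ : M) :
    ContMDiffAt (𝓘(ℝ, ℝ).prod 𝓘(ℝ, E)) 𝓘(ℝ, E →L[ℝ] E) ∞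
      (fun q : ℝ × M => frameChange (η q.1) x₀ (η t₀ x₀) q.2) (t₀, x₀) := by
  have h1 : ContMDiffAt (𝓘(ℝ, ℝ).prod 𝓘(ℝ, E)) 𝓘(ℝ, E →L[ℝ] E) ∞
      (inTangentCoordinates 𝓘(ℝ, E) 𝓘(ℝ, E) (fun q : ℝ × M => q.2)
        (fun q : ℝ × M => η q.1 q.2)
        (fun q => mfderiv 𝓘(ℝ, E) 𝓘(ℝ, E) (η q.1) q.2) (t₀, x₀)) (t₀, x₀) := by
    refine ContMDiffAt.mfderiv (n := ∞) (fun (q : ℝ × M) (y : M) => η q.1 y) (fun q => q.2)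
      ?_ contMDiffAt_snd (by simp)
    exact ContMDiffAt.comp ((t₀, x₀), x₀) (g := fun r : ℝ × M => η r.1 r.2)
      (f := fun s : (ℝ × M) × M => (s.1.1, s.2)) (hη (t₀, x₀))
      ((contMDiffAt_fst.comp (x := ((t₀, x₀), x₀)) (f := fun s : (ℝ × M) × M => s.1)
        (g := fun r : ℝ × M => r.1) contMDiffAt_fst).prodMk contMDiffAt_snd)
  have h2 : ∀ᶠ q : ℝ × M in 𝓝 (t₀, x₀),
      ((frameChange (η q.1) x₀ (η t₀ x₀) q.2 : (E →L[ℝ] E)ˣ) : E →L[ℝ] E) =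
      inTangentCoordinates 𝓘(ℝ, E) 𝓘(ℝ, E) (fun q : ℝ × M => q.2)
        (fun q : ℝ × M => η q.1 q.2)
        (fun q => mfderiv 𝓘(ℝ, E) 𝓘(ℝ, E) (η q.1) q.2) (t₀, x₀) q := by
    have ha : ∀ᶠ q : ℝ × M in 𝓝 (t₀, x₀),
        q.2 ∈ (trivializationAt E (TangentSpace 𝓘(ℝ, E)) x₀).baseSet :=
      continuousAt_snd.eventually_mem
        ((trivializationAt E (TangentSpace 𝓘(ℝ, E)) x₀).open_baseSet.mem_nhds
          (FiberBundle.mem_baseSet_trivializationAt' x₀))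
    have hb : ∀ᶠ q : ℝ × M in 𝓝 (t₀, x₀),
        η q.1 q.2 ∈ (trivializationAt E (TangentSpace 𝓘(ℝ, E)) (η t₀ x₀)).baseSet :=
      hη.continuous.continuousAt.eventually_mem
        ((trivializationAt E (TangentSpace 𝓘(ℝ, E)) (η t₀ x₀)).open_baseSet.mem_nhds
          (FiberBundle.mem_baseSet_trivializationAt' (η t₀ x₀)))
    filter_upwards [ha, hb] with q hqa hqb
    have hc := ContinuousLinearMap.inCoordinates_eq
      (ϕ := mfderiv 𝓘(ℝ, E) 𝓘(ℝ, E) (η q.1) q.2) hqa hqb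
    refine Eq.trans ?_ hc.symm
    ext v
    rw [frameChange, coordFrame_of_mem hqa, coordFrame_of_mem hqb]
    rfl
  have h3 := h1.congr_of_eventuallyEq h2
  have h4 := contMDiffOn_isOpenEmbedding_symm (I := 𝓘(ℝ, E →L[ℝ] E)) (n := ∞)
    (Units.isOpenEmbedding_val (R := E →L[ℝ] E))
  have h5 := h4.contMDiffAt (x := ((frameChange (η t₀) x₀ (η t₀ x₀) x₀ : (E →L[ℝ] E)ˣ) : E →L[ℝ] E))
    ((Units.isOpenEmbedding_val (R := E →L[ℝ] E)).isOpen_range.mem_nhds ⟨_, rfl⟩)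
  have h6 := ContMDiffAt.comp (t₀, x₀) h5 h3
  refine h6.congr_of_eventuallyEq (Filter.Eventually.of_forall fun q => ?_)
  exact ((Units.isOpenEmbedding_val (R := E →L[ℝ] E)).toOpenPartialHomeomorph_left_inv _).symm

theorem isSmoothCurve_pull_aux {ρ : FrameAction E V} {c : ℝ → Field ρ M} (hc : IsSmoothCurve c)
    {η : ℝ → Diff E M} (hη : IsSmoothDiffCurve η) (t₀ : ℝ) (x₀ : M) :
    ContMDiffAt (𝓘(ℝ, ℝ).prod 𝓘(ℝ, E)) 𝓘(ℝ, V) ∞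
      (fun q : ℝ × M => framePull (η q.1) (c q.1).toFun q.2 (coordFrame x₀ q.2)) (t₀, x₀) := by
  have key : (fun q : ℝ × M => framePull (η q.1) (c q.1).toFun q.2 (coordFrame x₀ q.2)) =
      fun q : ℝ × M => ρ.toHom (frameChange (η q.1) x₀ (η t₀ x₀) q.2)⁻¹
        ((c q.1).toFun (η q.1 q.2) (coordFrame (η t₀ x₀) (η q.1 q.2))) := by
    funext q
    rw [← (c q.1).equivariant, frameChange_trans]
    rfl
  rw [key]
  have h1 : ContMDiffAt (𝓘(ℝ, ℝ).prod 𝓘(ℝ, E)) 𝓘(ℝ, V) ∞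
      (fun q : ℝ × M => (c q.1).toFun (η q.1 q.2) (coordFrame (η t₀ x₀) (η q.1 q.2)))
      (t₀, x₀) :=
    ContMDiffAt.comp (t₀, x₀) (g := fun r : ℝ × M => (c r.1).toFun r.2 (coordFrame (η t₀ x₀) r.2))
      (f := fun q : ℝ × M => (q.1, η q.1 q.2)) (hc t₀ (η t₀ x₀))
      (contMDiffAt_fst.prodMk (hη (t₀, x₀)))
  have h2 := (frameChange_smooth hη t₀ x₀).inv
  exact ContMDiffAt.comp (t₀, x₀) (ρ.smooth _) (h2.prodMk h1)

theorem isSmoothDiffCurve_const (η : Diff E M) : IsSmoothDiffCurve (fun _ : ℝ => η) :=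
  η.contMDiff.comp contMDiff_snd

/-- The right action of `Diff(M)` on `Γ(𝒯)` by pullback, `R_η φ = η^* φ`. -/
def Field.pull {ρ : FrameAction E V} (η : Diff E M) (φ : Field ρ M) : Field ρ M where
  toFun := framePull η φ.toFun
  equivariant x e g := φ.equivariant (η x) (e.trans (diffAt η x)) g
  smooth x₀ :=
    ContMDiffAt.comp x₀ (isSmoothCurve_pull_aux (isSmoothCurve_const φ)
      (isSmoothDiffCurve_const η) 0 x₀) (contMDiffAt_const.prodMk contMDiffAt_id)

theorem isSmoothCurve_pull {ρ : FrameAction E V} {c : ℝ → Field ρ M} (hc : IsSmoothCurve c)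
    {η : ℝ → Diff E M} (hη : IsSmoothDiffCurve η) :
    IsSmoothCurve (fun t => (c t).pull (η t)) :=
  isSmoothCurve_pull_aux hc hη

theorem isSmoothCurve_reparam {ρ : FrameAction E V} {c : ℝ → Field ρ M} (hc : IsSmoothCurve c)
    (a : ℝ) : IsSmoothCurve (fun t => c (a * t)) := fun t₀ x₀ =>
  ContMDiffAt.comp (t₀, x₀) (g := fun r : ℝ × M => (c r.1).toFun r.2 (coordFrame x₀ r.2))
    (f := fun q : ℝ × M => (a * q.1, q.2)) (hc (a * t₀) x₀)
    ((((contDiff_const.mul contDiff_id).contMDiff.contMDiffAt (x := t₀)).comp (t₀, x₀)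
      contMDiffAt_fst).prodMk contMDiffAt_snd)

end

/-- A field space `Φ`: a `Diff(M)`-invariant set of smooth sections of `𝒯` whose velocities of
smooth curves through any given point of it form a vector space (only closure under addition
has to be asked for). The main example is `Γ(𝒯)` itself, see `FieldSpace.univ`. -/
structure FieldSpace {E : Type*} [NormedAddCommGroup E] [NormedSpace ℝ E] [CompleteSpace E]
    {V : Type*} [NormedAddCommGroup V] [NormedSpace ℝ V] (ρ : FrameAction E V)
    (M : Type*) [TopologicalSpace M] [ChartedSpace E M] [IsManifold 𝓘(ℝ, E) ∞ M] where
  carrier : Set (Field ρ M)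
  pull_mem : ∀ φ ∈ carrier, ∀ η : Diff E M, φ.pull η ∈ carrier
  velocity_add : ∀ φ ∈ carrier, ∀ c₁ c₂ : ℝ → Field ρ M,
    IsSmoothCurve c₁ → (∀ t, c₁ t ∈ carrier) → c₁ 0 = φ →
    IsSmoothCurve c₂ → (∀ t, c₂ t ∈ carrier) → c₂ 0 = φ →
    ∃ c₃ : ℝ → Field ρ M, IsSmoothCurve c₃ ∧ (∀ t, c₃ t ∈ carrier) ∧ c₃ 0 = φ ∧
      velocity c₃ = velocity c₁ + velocity c₂

section

variable {E : Type*} [NormedAddCommGroup E] [NormedSpace ℝ E] [CompleteSpace E]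
  {V : Type*} [NormedAddCommGroup V] [NormedSpace ℝ V]
  {M : Type*} [TopologicalSpace M] [ChartedSpace E M] [IsManifold 𝓘(ℝ, E) ∞ M]
  {ρ : FrameAction E V}

theorem differentiableAt_curve {c : ℝ → Field ρ M} (hc : IsSmoothCurve c) (t₀ : ℝ) (x : M)
    (e : Frame E x) : DifferentiableAt ℝ (fun t => (c t).toFun x e) t₀ := by
  have h1 : ContMDiffAt 𝓘(ℝ, ℝ) 𝓘(ℝ, V) ∞ (fun t : ℝ => (c t).toFun x (coordFrame x x)) t₀ :=
    ContMDiffAt.comp t₀ (g := fun r : ℝ × M => (c r.1).toFun r.2 (coordFrame x r.2))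
      (f := fun t : ℝ => (t, x)) (hc t₀ x) (contMDiffAt_id.prodMk contMDiffAt_const)
  set g : (E →L[ℝ] E)ˣ := (ContinuousLinearEquiv.unitsEquiv ℝ E).symm
    (e.trans (coordFrame x x).symm) with hg
  have h2 : (fun t => (c t).toFun x e) =
      fun t => ρ.toHom g⁻¹ ((c t).toFun x (coordFrame x x)) := by
    funext t
    rw [← (c t).equivariant]
    congr 1
    ext v
    simp [hg]
  rw [h2]
  have h3 : ContMDiffAt 𝓘(ℝ, ℝ) 𝓘(ℝ, V) ∞
      (fun t : ℝ => ρ.toHom g⁻¹ ((c t).toFun x (coordFrame x x))) t₀ :=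
    ContMDiffAt.comp t₀ (g := fun q : (E →L[ℝ] E)ˣ × V => ρ.toHom q.1 q.2)
      (f := fun t : ℝ => (g⁻¹, (c t).toFun x (coordFrame x x))) (ρ.smooth _)
      (contMDiffAt_const.prodMk h1)
  exact h3.contDiffAt.differentiableAt (by simp)

/-- The set of all smooth sections, `Φ = Γ(𝒯)`, is a field space. -/
def FieldSpace.univ (ρ : FrameAction E V) (M : Type*) [TopologicalSpace M] [ChartedSpace E M]
    [IsManifold 𝓘(ℝ, E) ∞ M] : FieldSpace ρ M where
  carrier := Set.univ
  pull_mem _ _ _ := trivial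
  velocity_add φ _ c₁ c₂ h₁ _ h₁0 h₂ _ h₂0 := by
    refine ⟨fun t =>
      { toFun := (c₁ t).toFun + (c₂ t).toFun - φ.toFun
        equivariant := fun x e g => ?_
        smooth := fun x₀ => ?_ }, ?_, fun _ => trivial, ?_, ?_⟩
    · have h' : ∀ a b d : V, ρ.toHom g⁻¹ (a + b - d) =
          ρ.toHom g⁻¹ a + ρ.toHom g⁻¹ b - ρ.toHom g⁻¹ d := by
        intro a b d
        have e1 := (ρ.toHom g⁻¹).map_vadd b (a - d)
        have e2 := (ρ.toHom g⁻¹).map_vadd d (a - d)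
        simp only [vadd_eq_add, sub_add_cancel] at e1 e2
        rw [show a + b - d = a - d + b by abel, e1, e2]
        abel
      simp only [Pi.add_apply, Pi.sub_apply, (c₁ t).equivariant, (c₂ t).equivariant,
        φ.equivariant, h']
    · exact (((c₁ t).smooth x₀).add ((c₂ t).smooth x₀)).sub (φ.smooth x₀)
    · intro t₀ x₀
      exact ((h₁ t₀ x₀).add (h₂ t₀ x₀)).sub (isSmoothCurve_const φ t₀ x₀)
    · ext1
      simp [h₁0, h₂0]
    · funext x e
      have d1 := differentiableAt_curve h₁ 0 x e
      have d2 := differentiableAt_curve h₂ 0 x e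
      simp only [velocity, Pi.add_apply, Pi.sub_apply]
      rw [deriv_sub_const, deriv_fun_add d1 d2]

namespace FieldSpace

variable (Φ : FieldSpace ρ M)

/-- The points of the field space. -/
abbrev Pt := {φ : Field ρ M // φ ∈ Φ.carrier}

/-- Smooth curves in the field space. -/
def SmoothCurve (c : ℝ → Φ.Pt) : Prop := IsSmoothCurve (fun t => (c t).1)

/-- Smooth maps `Φ → Φ`: those mapping smooth curves to smooth curves. -/
def SmoothMap (F : Φ.Pt → Φ.Pt) : Prop := ∀ c, Φ.SmoothCurve c → Φ.SmoothCurve (fun t => F (c t))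

/-- `C^∞(Φ, Diff(M))`: the maps `Φ → Diff(M)` mapping smooth curves to smooth curves. -/
def SmoothGenerating (ψ : Φ.Pt → Diff E M) : Prop :=
  ∀ c, Φ.SmoothCurve c → IsSmoothDiffCurve (fun t => ψ (c t))

/-- The right action `R_η : Φ → Φ`, `R_η φ = η^* φ`. -/
def R (η : Diff E M) (φ : Φ.Pt) : Φ.Pt := ⟨φ.1.pull η, Φ.pull_mem φ.1 φ.2 η⟩

theorem smoothMap_R (η : Diff E M) : Φ.SmoothMap (Φ.R η) := fun _ hc =>
  isSmoothCurve_pull hc (isSmoothDiffCurve_const η)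

/-- The moduli space `Φ / Diff(M)` of orbits. -/
def Moduli := Quot (fun φ φ' : Φ.Pt => ∃ η : Diff E M, φ' = Φ.R η φ)

/-- The projection `π : Φ → Φ / Diff(M)`. -/
def proj (φ : Φ.Pt) : Φ.Moduli := Quot.mk _ φ

/-- The group `Diff_v(Φ)` of vertical diffeomorphisms: diffeomorphisms `Ξ` of `Φ` such that
`π ∘ Ξ = π`. -/
structure VerticalDiffeo extends Equiv Φ.Pt Φ.Pt where
  smooth_toFun : Φ.SmoothMap toFun
  smooth_invFun : Φ.SmoothMap invFun
  vertical : ∀ φ, Φ.proj (toFun φ) = Φ.proj φ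

variable {Φ}

/-- A smooth curve in `Φ` through the point `φ` at time `0`, for instance a flow line. -/
structure CurveAt (φ : Φ.Pt) where
  toFun : ℝ → Φ.Pt
  smooth : Φ.SmoothCurve toFun
  zero : toFun 0 = φ

/-- The tangent space `T_φ Φ`: the vector space of velocities at time `0` of smooth curves in `Φ`
through `φ`. -/
def Tan (φ : Φ.Pt) : Submodule ℝ (FrameFun E V M) where
  carrier := {X | ∃ c : CurveAt φ, velocity (fun t => (c.toFun t).1) = X}
  zero_mem' := by
    refine ⟨⟨fun _ => φ, isSmoothCurve_const φ.1, rfl⟩, ?_⟩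
    funext x e
    simp [velocity]
  add_mem' := by
    rintro _ _ ⟨c₁, rfl⟩ ⟨c₂, rfl⟩
    obtain ⟨c, h, hm, h0, hv⟩ := Φ.velocity_add φ.1 φ.2 _ _ c₁.smooth (fun t => (c₁.toFun t).2)
      (congrArg Subtype.val c₁.zero) c₂.smooth (fun t => (c₂.toFun t).2)
      (congrArg Subtype.val c₂.zero)
    exact ⟨⟨fun t => ⟨c t, hm t⟩, h, Subtype.ext h0⟩, hv⟩
  smul_mem' := by
    rintro a _ ⟨c, rfl⟩
    refine ⟨⟨fun t => c.toFun (a * t), isSmoothCurve_reparam c.smooth a, by simp [c.zero]⟩, ?_⟩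
    funext x e
    have := deriv_comp_mul_left a (fun t => (c.toFun t).1.toFun x e) 0
    simpa [velocity] using this

namespace CurveAt

variable {φ : Φ.Pt}

/-- The tangent vector `d/dτ c_τ |_{τ = 0} ∈ T_φ Φ` of a curve through `φ`. -/
def vec (c : CurveAt φ) : Tan φ := ⟨velocity (fun t => (c.toFun t).1), c, rfl⟩

/-- The image curve `F ∘ c` under a smooth map `F : Φ → Φ`. -/
def map (c : CurveAt φ) {F : Φ.Pt → Φ.Pt} (hF : Φ.SmoothMap F) : CurveAt (F φ) :=
  ⟨fun t => F (c.toFun t), hF _ c.smooth, congrArg F c.zero⟩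

end CurveAt

/-- The pushforward `F_⋆ 𝔛 = d/dτ F(c_τ) |_{τ = 0} ∈ T_{F(φ)} Φ` of the vector `𝔛 ∈ T_φ Φ` that is
tangent to the curve `c`. -/
def push {F : Φ.Pt → Φ.Pt} (hF : Φ.SmoothMap F) {φ : Φ.Pt} (c : CurveAt φ) : Tan (F φ) :=
  (c.map hF).vec

/-- The differential `dψ_φ(𝔛) = d/dτ ψ(c_τ) |_{τ = 0} ∈ T_{ψ(φ)} Diff(M)` of `ψ : Φ → Diff(M)` on the
vector `𝔛 ∈ T_φ Φ` that is tangent to the curve `c`; a map `M → TM` covering `ψ(φ)`. -/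
def dGen (ψ : Φ.Pt → Diff E M) {φ : Φ.Pt} (c : CurveAt φ) : M → TM E M :=
  diffVelocity (fun t => ψ (c.toFun t))

/-- The pushforward `R_{η⋆} : T_φ Φ → T_{η^* φ} Φ` by the right action. As `R_η` extends to a linear
map on functions on `LM`, it is given by that map; see `push_R`. -/
def Rpush (η : Diff E M) (φ : Φ.Pt) : Tan φ →ₗ[ℝ] Tan (Φ.R η φ) :=
  (framePull η).restrict (by
    rintro _ ⟨c, rfl⟩
    exact ⟨c.map (Φ.smoothMap_R η), rfl⟩)

theorem push_R (η : Diff E M) {φ : Φ.Pt} (c : CurveAt φ) :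
    push (Φ.smoothMap_R η) c = Rpush η φ c.vec := rfl

/-- The curve `τ ↦ R_{η_τ} φ` for a smooth curve `η` in `Diff(M)` starting at the identity. -/
def orbitCurve (φ : Φ.Pt) {η : ℝ → Diff E M} (hη : IsSmoothDiffCurve η)
    (h0 : η 0 = Diffeomorph.refl 𝓘(ℝ, E) M ∞) : CurveAt φ where
  toFun t := Φ.R (η t) φ
  smooth := isSmoothCurve_pull (isSmoothCurve_const φ.1) hη
  zero := by
    refine Subtype.ext (Field.ext ?_)
    funext x e
    have h1 : e.trans (diffAt (Diffeomorph.refl 𝓘(ℝ, E) M ∞) x) = e := by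
      ext v
      have h2 : mfderiv 𝓘(ℝ, E) 𝓘(ℝ, E) (id : M → M) x =
        ContinuousLinearMap.id ℝ (TangentSpace 𝓘(ℝ, E) x) := mfderiv_id
      exact congrArg (fun A : TangentSpace 𝓘(ℝ, E) x →L[ℝ] TangentSpace 𝓘(ℝ, E) x => A (e v)) h2
    rw [h0]
    exact congrArg (φ.1.toFun x) h1

open Classical in
/-- The vertical vector `X^v|_φ = d/dτ R_{η_τ} φ |_{τ = 0} ∈ T_φ Φ` generated by the vector field
`X = d/dτ η_τ |_{τ = 0} ∈ diff(M)`, where `η` is a smooth curve in `Diff(M)` starting at the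
identity with velocity `X` (and `0` by convention if `X` is not such a velocity). -/
def vert (X : M → TM E M) (φ : Φ.Pt) : Tan φ :=
  if h : ∃ η : ℝ → Diff E M, IsSmoothDiffCurve η ∧ η 0 = Diffeomorph.refl 𝓘(ℝ, E) M ∞ ∧
      diffVelocity η = X then
    (orbitCurve φ h.choose_spec.1 h.choose_spec.2.1).vec
  else 0

end FieldSpace

/-- The Lie derivative `𝔏_X f` of a field `f` along the vector field `X`. In the coordinates `y` of
the chart around `x`, and the corresponding coordinate frame, it is the usual expression
`X^μ ∂_μ f - ρ_*(∂X) f`; the component in any other frame follows by the linear part of `ρ`. -/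
def lieDeriv (ρ : FrameAction E V) (X : M → TM E M) (f : FrameFun E V M) : FrameFun E V M :=
  fun x e =>
    let p : E → M := (extChartAt 𝓘(ℝ, E) x).symm
    let y₀ : E := extChartAt 𝓘(ℝ, E) x x
    let fc : E → V := fun y => f (p y) (coordFrame x (p y))
    let Xc : E → E := fun y => (trivializationAt E (TangentSpace 𝓘(ℝ, E)) x (X (p y))).2
    let g : (E →L[ℝ] E)ˣ :=
      (ContinuousLinearEquiv.unitsEquiv ℝ E).symm (e.trans (coordFrame x x).symm)
    (ρ.toHom g⁻¹).linear (fderiv ℝ fc y₀ (Xc y₀) - ρ.inf (fderiv ℝ Xc y₀) (fc y₀))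

namespace FieldSpace

/-- `W`-valued `k`-forms on `Φ`: an alternating `k`-linear form on each tangent space. -/
abbrev Form (Φ : FieldSpace ρ M) (k : ℕ) (W : Type*) [AddCommGroup W] [Module ℝ W] :=
  ∀ φ : Φ.Pt, (Tan φ) [⋀^Fin k]→ₗ[ℝ] W

variable {Φ : FieldSpace ρ M} {k : ℕ} {W : Type*} [AddCommGroup W] [Module ℝ W]

/-- The pullback `(F^⋆ α)_φ(𝔛₁, …, 𝔛ₖ) = α_{F(φ)}(F_⋆ 𝔛₁, …, F_⋆ 𝔛ₖ)`, where `𝔛ᵢ` is tangent to the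
curve `cᵢ`. -/
def Form.pullback (α : Form Φ k W) {F : Φ.Pt → Φ.Pt} (hF : Φ.SmoothMap F) {φ : Φ.Pt}
    (c : Fin k → CurveAt φ) : W :=
  α (F φ) (fun i => push hF (c i))

/-- The equivariance `R_η^⋆ α` of a form. -/
def Form.pullR (α : Form Φ k W) (η : Diff E M) : Form Φ k W :=
  fun φ => (α (Φ.R η φ)).compLinearMap (Rpush η φ)

/-- Horizontal forms: `ι_{X^v} α = 0`. -/
def Form.IsHorizontal (α : Form Φ k W) : Prop :=
  ∀ (φ : Φ.Pt) (X : M → TM E M) (v : Fin k → Tan φ) (i : Fin k), v i = vert X φ → α φ v = 0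

/-- `1`-cocycles for the action of `Diff(M)` on `Φ`:
`C(φ; η' ∘ η) = C(φ; η') C(η'^* φ; η)`. Those not depending on `φ` are the morphisms, hence the
representations, of `Diff(M)`. -/
def IsCocycle {G : Type*} [Group G] (C : Φ.Pt → Diff E M → G) : Prop :=
  ∀ (φ : Φ.Pt) (η' η : Diff E M), C φ (η.trans η') = C φ η' * C (Φ.R η' φ) η

/-- Equivariant forms, twisted by a cocycle `C`: `R_η^⋆ α = C( · ; η)⁻¹ α`. -/
def Form.IsEquivariant {G : Type*} [Group G] [DistribMulAction G W] (α : Form Φ k W)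
    (C : Φ.Pt → Diff E M → G) : Prop :=
  ∀ (η : Diff E M) (φ : Φ.Pt) (v : Fin k → Tan φ), α.pullR η φ v = (C φ η)⁻¹ • α φ v

/-- The basis `1`-form `dφ` on `Φ`: the tautological form, mapping a tangent vector of `Φ` at `φ` to
the variation of the field that it is. -/
def basisForm (Φ : FieldSpace ρ M) : Form Φ 1 (FrameFun E V M) :=
  fun φ => AlternatingMap.ofSubsingleton ℝ (Tan φ) (FrameFun E V M) 0 (Tan φ).subtype

end FieldSpace

end

end FieldSpaceGeometry

end

/-! Along a curve `c` through φ put η_t = ψ(c_t). Then Ξ(c_t) = η_t^* c_t is the diagonal of the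
two-parameter family (s, t) ↦ η_s^* c_t, so its velocity is the sum of two partial velocities
(`velocity_pull_curve`). Freezing η leaves the linear map η_0^* applied to the velocity of `c`, that
is R_{ψ(φ)⋆}𝔛. Freezing `c` leaves the velocity of η_t^* φ, which must be recognised as vertical.

This curve of diffeomorphisms starts at ψ(φ), not at the identity, and can be corrected on either
side. Writing η_t = η_0 ∘ (η_0⁻¹ ∘ η_t) gives a vertical vector at Ξ(φ); writing η_t = (η_t ∘ η_0⁻¹)
∘ η_0 gives the image under R_{η_0⋆} of a vertical vector at φ. These are the two forms of the
pushforward formula. The formula for forms is its substitution into α, and in the tensorial case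
multilinearity and horizontality remove the vertical vectors.

The analytic core is `velocity_pull`: for η_0 = id, the velocity of η_t^* φ is the Lie derivative
along the velocity of η. It gives the formula for dφ, and it also makes `vert`, defined by a chosen
curve, independent of that choice. In a chart η_t^* φ is ρ(A_t)⁻¹ v_t, with A_t the Jacobian matrix
and v_t the component of φ along t ↦ η_t(x); v_t contributes X^μ ∂_μ φ, and A_t contributes
-ρ_*(∂X)φ because ∂_t and ∂_y commute. -/

namespace FieldSpaceGeometry

/-! ### Calculus in normed spaces -/

section Calculus

variable {E F : Type*} [NormedAddCommGroup E] [NormedSpace ℝ E]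
  [NormedAddCommGroup F] [NormedSpace ℝ F]

/-- Symmetry of the second derivative: in the direction w, both sides are D²Z evaluated on (1, 0)
and (0, w), in opposite orders. Used to differentiate the Jacobian of a curve of diffeomorphisms in
time. -/
theorem hasDerivAt_fderiv_partial {Z : ℝ × E → F} {t₀ : ℝ} {y₀ : E}
    (hZ : ContDiffAt ℝ 2 Z (t₀, y₀)) :
    HasDerivAt (fun t => fderiv ℝ (fun y => Z (t, y)) y₀)
      (fderiv ℝ (fun y => deriv (fun t => Z (t, y)) t₀) y₀) t₀ := by
  have hd : ∀ᶠ q in 𝓝 (t₀, y₀), DifferentiableAt ℝ Z q := by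
    filter_upwards [hZ.eventually (by simp)] with q hq
    exact hq.differentiableAt (by simp)
  have hD : DifferentiableAt ℝ (fderiv ℝ Z) (t₀, y₀) :=
    (hZ.fderiv_right (m := 1) (by norm_num)).differentiableAt (by simp)
  have hsymm : IsSymmSndFDerivAt ℝ Z (t₀, y₀) := hZ.isSymmSndFDerivAt (by simp)
  have ht : ∀ᶠ t in 𝓝 t₀, fderiv ℝ (fun y => Z (t, y)) y₀ =
      (fderiv ℝ Z (t, y₀)).comp (ContinuousLinearMap.inr ℝ ℝ E) := by
    have hc : Filter.Tendsto (fun t : ℝ => (t, y₀)) (𝓝 t₀) (𝓝 (t₀, y₀)) :=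
      (continuous_id.prodMk continuous_const).continuousAt
    filter_upwards [hc.eventually hd] with t h
    exact (h.hasFDerivAt.comp y₀ (hasFDerivAt_prodMk_right t y₀)).fderiv
  have hy : ∀ᶠ y in 𝓝 y₀, deriv (fun t => Z (t, y)) t₀ = fderiv ℝ Z (t₀, y) (1, 0) := by
    have hc : Filter.Tendsto (fun y : E => (t₀, y)) (𝓝 y₀) (𝓝 (t₀, y₀)) :=
      (continuous_const.prodMk continuous_id).continuousAt
    filter_upwards [hc.eventually hd] with y h
    exact (h.hasFDerivAt.comp_hasDerivAt t₀ ((hasDerivAt_id t₀).prodMk (hasDerivAt_const t₀ y))).deriv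
  have h1 : HasDerivAt (fun t => fderiv ℝ Z (t, y₀)) (fderiv ℝ (fderiv ℝ Z) (t₀, y₀) (1, 0)) t₀ :=
    hD.hasFDerivAt.comp_hasDerivAt t₀ ((hasDerivAt_id t₀).prodMk (hasDerivAt_const t₀ y₀))
  have h2 : HasFDerivAt (fun y => fderiv ℝ Z (t₀, y) (1, 0))
      ((ContinuousLinearMap.apply ℝ F ((1, 0) : ℝ × E)).comp
        ((fderiv ℝ (fderiv ℝ Z) (t₀, y₀)).comp (ContinuousLinearMap.inr ℝ ℝ E))) y₀ :=
    (ContinuousLinearMap.apply ℝ F ((1, 0) : ℝ × E)).hasFDerivAt.comp y₀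
      (hD.hasFDerivAt.comp y₀ (hasFDerivAt_prodMk_right t₀ y₀))
  have h3 : HasDerivAt (fun t => (fderiv ℝ Z (t, y₀)).comp (ContinuousLinearMap.inr ℝ ℝ E))
      ((fderiv ℝ (fderiv ℝ Z) (t₀, y₀) (1, 0)).comp (ContinuousLinearMap.inr ℝ ℝ E)) t₀ := by
    simpa using h1.clm_comp (hasDerivAt_const t₀ (ContinuousLinearMap.inr ℝ ℝ E))
  rw [Filter.EventuallyEq.fderiv_eq hy, h2.fderiv]
  refine (h3.congr_of_eventuallyEq ht).congr_deriv ?_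
  ext w
  exact hsymm _ _

/-- DG(1, 1) = DG(1, 0) + DG(0, 1). This serves as the Leibniz rule whenever both the acting element
and the object acted on move. -/
theorem hasDerivAt_diag {G : ℝ × ℝ → F} {t₀ : ℝ} (hG : DifferentiableAt ℝ G (t₀, t₀)) :
    HasDerivAt (fun t => G (t, t))
      (deriv (fun t => G (t, t₀)) t₀ + deriv (fun t => G (t₀, t)) t₀) t₀ := by
  have h1 : HasDerivAt (fun t => G (t, t₀)) (fderiv ℝ G (t₀, t₀) (1, 0)) t₀ :=
    HasFDerivAt.comp_hasDerivAt (f := fun t => (t, t₀)) t₀ hG.hasFDerivAt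
       ((hasDerivAt_id t₀).prodMk (hasDerivAt_const t₀ t₀))
  have h2 : HasDerivAt (fun t => G (t₀, t)) (fderiv ℝ G (t₀, t₀) (0, 1)) t₀ :=
    HasFDerivAt.comp_hasDerivAt (f := fun t => (t₀, t)) t₀ hG.hasFDerivAt
       ((hasDerivAt_const t₀ t₀).prodMk (hasDerivAt_id t₀))
  have h3 : HasDerivAt (fun t => G (t, t)) (fderiv ℝ G (t₀, t₀) (1, 1)) t₀ :=
    HasFDerivAt.comp_hasDerivAt (f := fun t => (t, t)) t₀ hG.hasFDerivAt
       ((hasDerivAt_id t₀).prodMk (hasDerivAt_id t₀))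
  rw [h1.deriv, h2.deriv, ← map_add]
  simpa using h3

theorem hasDerivAt_units_inv {R : Type*} [NormedRing R] [NormedAlgebra ℝ R] [CompleteSpace R]
    {A : ℝ → Rˣ} {A' : R} {t₀ : ℝ} (hA : A t₀ = 1) (hA' : HasDerivAt (fun t => (A t : R)) A' t₀) :
    HasDerivAt (fun t => (((A t)⁻¹ : Rˣ) : R)) (-A') t₀ := by
  have h1 := (hasFDerivAt_ringInverse (𝕜 := ℝ) (A t₀)).comp_hasDerivAt t₀ hA'
  simp only [Function.comp_def, Ring.inverse_unit] at h1
  refine h1.congr_deriv ?_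
  rw [neg_apply, ContinuousLinearMap.mulLeftRight_apply, hA]
  simp only [inv_one, Units.val_one, one_mul, mul_one]

end Calculus

/-! ### Differentiating the structure group action -/

section

variable {E : Type*} [NormedAddCommGroup E] [NormedSpace ℝ E] [CompleteSpace E]
  {V : Type*} [NormedAddCommGroup V] [NormedSpace ℝ V]
  {M : Type*} [TopologicalSpace M] [ChartedSpace E M] [IsManifold 𝓘(ℝ, E) ∞ M]
  {ρ : FrameAction E V}

/-- The chart on the units is their open inclusion into the algebra, so manifold derivatives there
are ordinary ones. This links `FrameAction.inf`, defined by `mfderiv`, to derivatives of matrices.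
-/
theorem mfderiv_units_curve {u : ℝ → (E →L[ℝ] E)ˣ} {t₀ : ℝ}
    (hu : MDifferentiableAt 𝓘(ℝ, ℝ) 𝓘(ℝ, E →L[ℝ] E) u t₀) :
    (mfderiv 𝓘(ℝ, ℝ) 𝓘(ℝ, E →L[ℝ] E) u t₀ : ℝ →L[ℝ] (E →L[ℝ] E)) =
      fderiv ℝ (fun t => (u t : E →L[ℝ] E)) t₀ := by
  rw [hu.mfderiv]
  simp only [writtenInExtChartAt, mfld_simps, fderivWithin_univ]
  rfl

/-- The derivative of a curve in `V` moved by a curve in the structure group starting at the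
identity. -/
theorem FrameAction.hasDerivAt_inv_apply (ρ : FrameAction E V) {A : ℝ → (E →L[ℝ] E)ˣ} {v : ℝ → V}
    (hA : ContMDiffAt 𝓘(ℝ, ℝ) 𝓘(ℝ, E →L[ℝ] E) ∞ A 0) (hA0 : A 0 = 1)
    {A' : E →L[ℝ] E} (hA' : HasDerivAt (fun t => (A t : E →L[ℝ] E)) A' 0)
    (hv : ContDiffAt ℝ ∞ v 0) :
    HasDerivAt (fun t => ρ.toHom (A t)⁻¹ (v t)) (deriv v 0 - ρ.inf A' (v 0)) 0 := by
  have hG : DifferentiableAt ℝ (fun q : ℝ × ℝ => ρ.toHom (A q.1)⁻¹ (v q.2)) (0, 0) := by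
    have h1 : ContMDiffAt 𝓘(ℝ, ℝ × ℝ) 𝓘(ℝ, E →L[ℝ] E) ∞ (fun q : ℝ × ℝ => A q.1) (0, 0) :=
      ContMDiffAt.comp ((0, 0) : ℝ × ℝ) (g := A) (f := Prod.fst) hA contDiff_fst.contMDiff.contMDiffAt
    have h2 : ContMDiffAt 𝓘(ℝ, ℝ × ℝ) 𝓘(ℝ, V) ∞ (fun q : ℝ × ℝ => v q.2) (0, 0) :=
      ContMDiffAt.comp ((0, 0) : ℝ × ℝ) (g := v) (f := Prod.snd) hv.contMDiffAt
        contDiff_snd.contMDiff.contMDiffAt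
    have h3 := ContMDiffAt.comp ((0, 0) : ℝ × ℝ) (ρ.smooth _) (h1.inv.prodMk h2)
    exact h3.contDiffAt.differentiableAt (by simp)
  have hinv := hasDerivAt_units_inv hA0 hA'
  have hpart : deriv (fun t => ρ.toHom (A t)⁻¹ (v 0)) 0 = - ρ.inf A' (v 0) := by
    have hF : MDifferentiableAt 𝓘(ℝ, E →L[ℝ] E) 𝓘(ℝ, V)
        (fun g : (E →L[ℝ] E)ˣ => ρ.toHom g (v 0)) (A 0)⁻¹ :=
      (ContMDiffAt.comp (A 0)⁻¹ (ρ.smooth _)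
        (contMDiffAt_id.prodMk contMDiffAt_const)).mdifferentiableAt (by simp)
    have hAi := hA.inv.mdifferentiableAt (by simp)
    have h1 := mfderiv_comp (0 : ℝ) hF hAi
    rw [← fderiv_apply_one_eq_deriv, ← mfderiv_eq_fderiv]
    have h2 := mfderiv_units_curve hAi
    have h3 := congrArg (fun L : ℝ →L[ℝ] (E →L[ℝ] E) => L 1) h2
    simp only [fderiv_apply_one_eq_deriv, hinv.deriv] at h3
    refine (congrArg (fun L : ℝ →L[ℝ] V => L 1) h1).trans ?_
    -- The chain rule yields the derivative at `(A 0)⁻¹`, equal to 1 only propositionally; the base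
    -- point is a variable so that it can be substituted.
    have h4 : ∀ g : (E →L[ℝ] E)ˣ, g = 1 →
        (mfderiv 𝓘(ℝ, E →L[ℝ] E) 𝓘(ℝ, V) (fun g : (E →L[ℝ] E)ˣ => ρ.toHom g (v 0)) g :
          (E →L[ℝ] E) →L[ℝ] V) (-A') = - ρ.inf A' (v 0) := by
      rintro _ rfl
      exact ContinuousLinearMap.map_neg (R := ℝ) (M := E →L[ℝ] E) (M₂ := V)
        (mfderiv 𝓘(ℝ, E →L[ℝ] E) 𝓘(ℝ, V) (fun g : (E →L[ℝ] E)ˣ => ρ.toHom g (v 0)) 1) A'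
    rw [← h4 (A 0)⁻¹ (by simp [hA0]), ← h3]
    rfl
  have h := hasDerivAt_diag hG
  refine h.congr_deriv ?_
  simp only [hpart, hA0]
  simp [neg_add_eq_sub]

/-- An affine map is its linear part plus a constant, and the linear part is continuous in finite
dimension. Hence the `linear` in `lieDeriv`. -/
theorem FrameAction.hasDerivAt_apply [FiniteDimensional ℝ V] (ρ : FrameAction E V)
    (g : (E →L[ℝ] E)ˣ) {v : ℝ → V} {v' : V} {t₀ : ℝ} (hv : HasDerivAt v v' t₀) :
    HasDerivAt (fun t => ρ.toHom g (v t)) ((ρ.toHom g).linear v') t₀ := by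
  have h1 : (fun t => ρ.toHom g (v t)) =
      fun t => LinearMap.toContinuousLinearMap ((ρ.toHom g).linear : V →ₗ[ℝ] V) (v t) +
        ρ.toHom g 0 := by
    funext t
    simpa using congrFun ((ρ.toHom g : V →ᵃ[ℝ] V).decomp) (v t)
  rw [h1]
  exact ((LinearMap.toContinuousLinearMap
    ((ρ.toHom g).linear : V →ₗ[ℝ] V)).hasFDerivAt.comp_hasDerivAt t₀ hv).add_const _

end

/-! ### Curves of diffeomorphisms in charts -/

section

variable {E : Type*} [NormedAddCommGroup E] [NormedSpace ℝ E]
  {M : Type*} [TopologicalSpace M] [ChartedSpace E M] [IsManifold 𝓘(ℝ, E) ∞ M]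

/-- A curve of diffeomorphisms read in the preferred chart around `x`. -/
noncomputable def chartRep (η : ℝ → Diff E M) (x : M) (q : ℝ × E) : E :=
  extChartAt 𝓘(ℝ, E) x (η q.1 ((extChartAt 𝓘(ℝ, E) x).symm q.2))

variable {η : ℝ → Diff E M}

/-- Smoothness is available at time 0 because η_0 = id keeps the image of x inside the domain of the
chart around x. -/
theorem contDiffAt_chartRep (hη : IsSmoothDiffCurve η)
    (h0 : η 0 = Diffeomorph.refl 𝓘(ℝ, E) M ∞) (x : M) :
    ContDiffAt ℝ ∞ (chartRep η x) (0, extChartAt 𝓘(ℝ, E) x x) := by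
  have h1 : ContMDiffAt 𝓘(ℝ, E) 𝓘(ℝ, E) ∞ (extChartAt 𝓘(ℝ, E) x).symm (extChartAt 𝓘(ℝ, E) x x) :=
    (contMDiffOn_extChartAt_symm x).contMDiffAt (extChartAt_target_mem_nhds x)
  have h2 : ContMDiffAt 𝓘(ℝ, ℝ × E) 𝓘(ℝ, E) ∞
      (fun q : ℝ × E => (extChartAt 𝓘(ℝ, E) x).symm q.2) (0, extChartAt 𝓘(ℝ, E) x x) :=
    ContMDiffAt.comp ((0 : ℝ), extChartAt 𝓘(ℝ, E) x x) (f := Prod.snd) h1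
      contDiff_snd.contMDiff.contMDiffAt
  have h3 : ContMDiffAt 𝓘(ℝ, ℝ × E) 𝓘(ℝ, ℝ) ∞
      (fun q : ℝ × E => q.1) (0, extChartAt 𝓘(ℝ, E) x x) :=
    contDiff_fst.contMDiff.contMDiffAt
  have h4 : ContMDiffAt 𝓘(ℝ, ℝ × E) 𝓘(ℝ, E) ∞
      (fun q : ℝ × E => η q.1 ((extChartAt 𝓘(ℝ, E) x).symm q.2))
      (0, extChartAt 𝓘(ℝ, E) x x) :=
    ContMDiffAt.comp ((0 : ℝ), extChartAt 𝓘(ℝ, E) x x) (g := fun r : ℝ × M => η r.1 r.2)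
      (f := fun q : ℝ × E => (q.1, (extChartAt 𝓘(ℝ, E) x).symm q.2)) (hη _) (h3.prodMk h2)
  refine ContMDiffAt.contDiffAt ?_
  refine ContMDiffAt.comp ((0 : ℝ), extChartAt 𝓘(ℝ, E) x x) (g := extChartAt 𝓘(ℝ, E) x)
      (f := fun q : ℝ × E => η q.1 ((extChartAt 𝓘(ℝ, E) x).symm q.2)) ?_ h4
  simp only [h0, extChartAt_to_inv]
  exact contMDiffAt_extChartAt

theorem IsSmoothDiffCurve.contMDiff_apply (hη : IsSmoothDiffCurve η) (x : M) :
    ContMDiff 𝓘(ℝ, ℝ) 𝓘(ℝ, E) ∞ (fun t => η t x) :=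
  ContMDiff.comp (g := fun r : ℝ × M => η r.1 r.2) (f := fun t : ℝ => (t, x)) hη
    (contMDiff_id.prodMk contMDiff_const)

theorem IsSmoothDiffCurve.eventually_mem_source (hη : IsSmoothDiffCurve η)
    (h0 : η 0 = Diffeomorph.refl 𝓘(ℝ, E) M ∞) (x : M) :
    ∀ᶠ t in 𝓝 (0 : ℝ), η t x ∈ (chartAt E x).source := by
  refine (hη.contMDiff_apply x).continuous.continuousAt.eventually_mem ?_
  rw [h0]
  exact chart_source_mem_nhds E x

/-- The preferred trivialization of TM is the differential of the chart. This makes coordinate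
frames accessible to the chain rule. -/
theorem trivializationAt_snd_eq_mfderiv {x p : M} (hp : p ∈ (chartAt E x).source)
    (v : TangentSpace 𝓘(ℝ, E) p) :
    (trivializationAt E (TangentSpace 𝓘(ℝ, E)) x ⟨p, v⟩).2 =
      (mfderiv 𝓘(ℝ, E) 𝓘(ℝ, E) (extChartAt 𝓘(ℝ, E) x) p : TangentSpace 𝓘(ℝ, E) p →L[ℝ] E) v := by
  have h := TangentBundle.continuousLinearMapAt_trivializationAt (I := 𝓘(ℝ, E)) hp
  refine Eq.trans ?_ (congrArg (fun L : TangentSpace 𝓘(ℝ, E) p →L[ℝ] E => L v) h)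
  exact (congrFun (Trivialization.coe_linearMapAt_of_mem (R := ℝ)
    (trivializationAt E (TangentSpace 𝓘(ℝ, E)) x) hp) v).symm

theorem trivializationAt_diffVelocity (hη : IsSmoothDiffCurve η) {x p : M}
    (hp : η 0 p ∈ (chartAt E x).source) :
    (trivializationAt E (TangentSpace 𝓘(ℝ, E)) x (diffVelocity η p)).2 =
      deriv (fun t => extChartAt 𝓘(ℝ, E) x (η t p)) 0 := by
  refine (trivializationAt_snd_eq_mfderiv hp _).trans ?_
  have h := mfderiv_comp (0 : ℝ) (g := extChartAt 𝓘(ℝ, E) x) (f := fun t => η t p)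
    ((contMDiffAt_extChartAt' (n := ∞) hp).mdifferentiableAt (by simp))
    ((hη.contMDiff_apply p).mdifferentiableAt (by simp))
  rw [← fderiv_apply_one_eq_deriv, ← mfderiv_eq_fderiv]
  exact (congrArg (fun L : ℝ →L[ℝ] E => L 1) h).symm

variable [CompleteSpace E]

/-- Chain rule for chart ∘ η_t ∘ chart⁻¹: the coordinate frame at x is the differential of chart⁻¹,
and the inverse frame at η_t(x) is that of the chart. -/
theorem frameChange_eq_fderiv (η : ℝ → Diff E M) {x : M} {t : ℝ}
    (ht : η t x ∈ (chartAt E x).source) :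
    (frameChange (η t) x x x : E →L[ℝ] E) =
      fderiv ℝ (fun y => chartRep η x (t, y)) (extChartAt 𝓘(ℝ, E) x x) := by
  have hx : x ∈ (chartAt E x).source := mem_chart_source E x
  have hs := TangentBundle.symmL_trivializationAt (I := 𝓘(ℝ, E)) hx
  rw [ModelWithCorners.range_eq_univ, mfderivWithin_univ] at hs
  have h1 : MDifferentiableAt 𝓘(ℝ, E) 𝓘(ℝ, E) (extChartAt 𝓘(ℝ, E) x).symm
      (extChartAt 𝓘(ℝ, E) x x) :=
    ((contMDiffOn_extChartAt_symm (n := ∞) x).contMDiffAt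
      (extChartAt_target_mem_nhds x)).mdifferentiableAt (by simp)
  have hxx : (extChartAt 𝓘(ℝ, E) x).symm (extChartAt 𝓘(ℝ, E) x x) = x := extChartAt_to_inv x
  have h2 : MDifferentiableAt 𝓘(ℝ, E) 𝓘(ℝ, E) (η t) x :=
    (η t).contMDiff.mdifferentiableAt (by simp)
  have h3 : MDifferentiableAt 𝓘(ℝ, E) 𝓘(ℝ, E) (extChartAt 𝓘(ℝ, E) x) (η t x) :=
    (contMDiffAt_extChartAt' (n := ∞) ht).mdifferentiableAt (by simp)
  -- The chain rule produces the base point chart⁻¹(chart x), which is not x by definition; z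
  -- absorbs the difference.
  have h4 : ∀ z, (extChartAt 𝓘(ℝ, E) x).symm (extChartAt 𝓘(ℝ, E) x x) = z →
      MDifferentiableAt 𝓘(ℝ, E) 𝓘(ℝ, E) (η t) z →
      MDifferentiableAt 𝓘(ℝ, E) 𝓘(ℝ, E) (extChartAt 𝓘(ℝ, E) x) (η t z) →
      (mfderiv 𝓘(ℝ, E) 𝓘(ℝ, E) (fun y => chartRep η x (t, y))
        (extChartAt 𝓘(ℝ, E) x x) : E →L[ℝ] E) =
        (mfderiv 𝓘(ℝ, E) 𝓘(ℝ, E) (extChartAt 𝓘(ℝ, E) x) (η t z) : E →L[ℝ] E).comp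
          ((mfderiv 𝓘(ℝ, E) 𝓘(ℝ, E) (η t) z : E →L[ℝ] E).comp
            (mfderiv 𝓘(ℝ, E) 𝓘(ℝ, E) (extChartAt 𝓘(ℝ, E) x).symm
              (extChartAt 𝓘(ℝ, E) x x) : E →L[ℝ] E)) := by
    rintro _ rfl hz hz'
    refine (mfderiv_comp _ (g := extChartAt 𝓘(ℝ, E) x)
      (f := η t ∘ (extChartAt 𝓘(ℝ, E) x).symm) hz' (hz.comp _ h1)).trans ?_
    rw [mfderiv_comp _ hz h1]
    rfl
  rw [← mfderiv_eq_fderiv]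
  refine Eq.trans ?_ (h4 x hxx h2 h3).symm
  ext w
  refine Eq.trans ?_ (congrArg (fun L : E →L[ℝ] TangentSpace 𝓘(ℝ, E) x =>
    mfderiv 𝓘(ℝ, E) 𝓘(ℝ, E) (extChartAt 𝓘(ℝ, E) x) (η t x)
      (mfderiv 𝓘(ℝ, E) 𝓘(ℝ, E) (η t) x (L w))) hs)
  refine Eq.trans ?_ (trivializationAt_snd_eq_mfderiv ht _)
  rw [frameChange, coordFrame_of_mem hx, coordFrame_of_mem ht]
  rw [← congrFun (Trivialization.symm_continuousLinearEquivAt_eq (R := ℝ)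
    (trivializationAt E (TangentSpace 𝓘(ℝ, E)) x) hx) w]
  rfl

/-- The time derivative of the Jacobian is the matrix ∂X, by exchanging ∂_t and ∂_y in `chartRep`.
The chart descriptions hold only near t = 0 and near the image of x, which suffices for derivatives.
-/
theorem hasDerivAt_frameChange (hη : IsSmoothDiffCurve η)
    (h0 : η 0 = Diffeomorph.refl 𝓘(ℝ, E) M ∞) (x : M) :
    HasDerivAt (fun t => (frameChange (η t) x x x : E →L[ℝ] E))
      (fderiv ℝ (fun y => (trivializationAt E (TangentSpace 𝓘(ℝ, E)) x
        (diffVelocity η ((extChartAt 𝓘(ℝ, E) x).symm y))).2) (extChartAt 𝓘(ℝ, E) x x)) 0 := by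
  have h1 := hasDerivAt_fderiv_partial ((contDiffAt_chartRep hη h0 x).of_le (by norm_cast))
  have h2 : ∀ᶠ t in 𝓝 (0 : ℝ), (frameChange (η t) x x x : E →L[ℝ] E) =
      fderiv ℝ (fun y => chartRep η x (t, y)) (extChartAt 𝓘(ℝ, E) x x) := by
    filter_upwards [hη.eventually_mem_source h0 x] with t ht
    exact frameChange_eq_fderiv η ht
  have h3 : ∀ᶠ y in 𝓝 (extChartAt 𝓘(ℝ, E) x x), (trivializationAt E (TangentSpace 𝓘(ℝ, E)) x
        (diffVelocity η ((extChartAt 𝓘(ℝ, E) x).symm y))).2 =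
      deriv (fun t => chartRep η x (t, y)) 0 := by
    filter_upwards [extChartAt_target_mem_nhds (I := 𝓘(ℝ, E)) x] with y hy
    refine trivializationAt_diffVelocity hη ?_
    rw [h0]
    simpa using (extChartAt 𝓘(ℝ, E) x).map_target hy
  rw [Filter.EventuallyEq.fderiv_eq h3]
  exact h1.congr_of_eventuallyEq h2

theorem diffAt_refl (x : M) : diffAt (Diffeomorph.refl 𝓘(ℝ, E) M ∞) x =
    ContinuousLinearEquiv.refl ℝ (TangentSpace 𝓘(ℝ, E) x) := by
  ext v
  have h2 : mfderiv 𝓘(ℝ, E) 𝓘(ℝ, E) (id : M → M) x =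
    ContinuousLinearMap.id ℝ (TangentSpace 𝓘(ℝ, E) x) := mfderiv_id
  exact congrArg (fun A : TangentSpace 𝓘(ℝ, E) x →L[ℝ] TangentSpace 𝓘(ℝ, E) x => A v) h2

theorem frameChange_refl (x : M) :
    frameChange (Diffeomorph.refl 𝓘(ℝ, E) M ∞) x x x = 1 := by
  rw [frameChange, diffAt_refl]
  ext v
  exact ContinuousLinearEquiv.symm_apply_apply (coordFrame x x) v

end

/-! ### Pullback of sections and the Lie derivative -/

section

variable {E : Type*} [NormedAddCommGroup E] [NormedSpace ℝ E] [CompleteSpace E]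
  {V : Type*} [NormedAddCommGroup V] [NormedSpace ℝ V]
  {M : Type*} [TopologicalSpace M] [ChartedSpace E M] [IsManifold 𝓘(ℝ, E) ∞ M]
  {ρ : FrameAction E V} {η : ℝ → Diff E M}

/-- The element of the structure group taking the coordinate frame at `x` to the frame `e`. -/
noncomputable def frameGroupElement {x : M} (e : Frame E x) : (E →L[ℝ] E)ˣ :=
  (ContinuousLinearEquiv.unitsEquiv ℝ E).symm (e.trans (coordFrame x x).symm)

theorem Field.apply_frame (φ : Field ρ M) {x : M} (e : Frame E x) :
    φ.toFun x e = ρ.toHom (frameGroupElement e)⁻¹ (φ.toFun x (coordFrame x x)) := by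
  rw [← φ.equivariant]
  congr 1
  ext v
  simp [frameGroupElement]

/-- The frame dη ∘ e lives over a moving point. Equivariance trades it for a matrix acting through ρ
on a coordinate component, and both of these can be differentiated. -/
theorem framePull_coordFrame (ζ : Diff E M) (φ : Field ρ M) (x x₁ : M) :
    framePull ζ φ.toFun x (coordFrame x x) =
      ρ.toHom (frameChange ζ x x₁ x)⁻¹ (φ.toFun (ζ x) (coordFrame x₁ (ζ x))) := by
  rw [← φ.equivariant, frameChange_trans]
  rfl

theorem framePull_trans (η η' : Diff E M) (f : FrameFun E V M) :
    framePull (η.trans η') f = framePull η (framePull η' f) := by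
  funext x e
  have h : diffAt (η.trans η') x = (diffAt η x).trans (diffAt η' (η x)) := by
    ext v
    have h1 := mfderiv_comp (I := 𝓘(ℝ, E)) (I' := 𝓘(ℝ, E)) (I'' := 𝓘(ℝ, E)) x
      (η'.contMDiff.mdifferentiableAt (x := η x) (by simp))
      (η.contMDiff.mdifferentiableAt (x := x) (by simp))
    exact congrArg (fun L : TangentSpace 𝓘(ℝ, E) x →L[ℝ] TangentSpace 𝓘(ℝ, E) (η' (η x)) => L v) h1
  change f _ (e.trans (diffAt (η.trans η') x)) = _
  rw [h]
  rfl

/-- The two-parameter pullback `η_t^* c_s` of a smooth curve of sections. -/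
theorem differentiableAt_framePull {c : ℝ → Field ρ M} (hc : IsSmoothCurve c)
    (hη : IsSmoothDiffCurve η) (q₀ : ℝ × ℝ) (x : M) (e : Frame E x) :
    DifferentiableAt ℝ (fun q : ℝ × ℝ => framePull (η q.1) (c q.2).toFun x e) q₀ := by
  -- The target chart is frozen at the point reached at parameter `q₀.1`, so matrix and component
  -- vary smoothly near `q₀`.
  have key : (fun q : ℝ × ℝ => framePull (η q.1) (c q.2).toFun x e) = fun q : ℝ × ℝ =>
      ρ.toHom (frameGroupElement e)⁻¹ (ρ.toHom (frameChange (η q.1) x (η q₀.1 x) x)⁻¹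
        ((c q.2).toFun (η q.1 x) (coordFrame (η q₀.1 x) (η q.1 x)))) := by
    funext q
    rw [← framePull_coordFrame]
    exact ((c q.2).pull (η q.1)).apply_frame e
  rw [key]
  have h1 : ContMDiffAt 𝓘(ℝ, ℝ × ℝ) 𝓘(ℝ, ℝ) ∞ (Prod.fst : ℝ × ℝ → ℝ) q₀ :=
    contDiff_fst.contMDiff.contMDiffAt
  have h2 : ContMDiffAt 𝓘(ℝ, ℝ × ℝ) 𝓘(ℝ, ℝ) ∞ (Prod.snd : ℝ × ℝ → ℝ) q₀ :=
    contDiff_snd.contMDiff.contMDiffAt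
  have h3 : ContMDiffAt 𝓘(ℝ, ℝ × ℝ) 𝓘(ℝ, E) ∞ (fun q : ℝ × ℝ => η q.1 x) q₀ :=
    ContMDiffAt.comp q₀ (g := fun t => η t x) (f := Prod.fst)
      (hη.contMDiff_apply x).contMDiffAt h1
  have h4 : ContMDiffAt 𝓘(ℝ, ℝ × ℝ) 𝓘(ℝ, V) ∞
      (fun q : ℝ × ℝ => (c q.2).toFun (η q.1 x) (coordFrame (η q₀.1 x) (η q.1 x))) q₀ :=
    ContMDiffAt.comp q₀ (g := fun r : ℝ × M => (c r.1).toFun r.2 (coordFrame (η q₀.1 x) r.2))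
      (f := fun q : ℝ × ℝ => (q.2, η q.1 x)) (hc q₀.2 (η q₀.1 x)) (h2.prodMk h3)
  have h5 : ContMDiffAt 𝓘(ℝ, ℝ × ℝ) 𝓘(ℝ, E →L[ℝ] E) ∞
      (fun q : ℝ × ℝ => frameChange (η q.1) x (η q₀.1 x) x) q₀ :=
    ContMDiffAt.comp q₀ (g := fun r : ℝ × M => frameChange (η r.1) x (η q₀.1 x) r.2)
      (f := fun q : ℝ × ℝ => (q.1, x)) (frameChange_smooth hη q₀.1 x)
      (h1.prodMk contMDiffAt_const)
  have h6 := ContMDiffAt.comp q₀ (ρ.smooth _) (h5.inv.prodMk h4)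
  have h7 := ContMDiffAt.comp q₀ (ρ.smooth _)
    ((contMDiffAt_const (c := (frameGroupElement e)⁻¹)).prodMk h6)
  exact h7.contDiffAt.differentiableAt (by simp)

/-- The velocity of the pullback of a section by a curve of diffeomorphisms starting at the
identity is the Lie derivative along the velocity of the curve. -/
theorem velocity_pull [FiniteDimensional ℝ V] (φ : Field ρ M) (hη : IsSmoothDiffCurve η)
    (h0 : η 0 = Diffeomorph.refl 𝓘(ℝ, E) M ∞) :
    velocity (fun t => φ.pull (η t)) = lieDeriv ρ (diffVelocity η) φ.toFun := by
  funext x e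
  set y₀ : E := extChartAt 𝓘(ℝ, E) x x with hy₀
  set fc : E → V := fun y => φ.toFun ((extChartAt 𝓘(ℝ, E) x).symm y)
    (coordFrame x ((extChartAt 𝓘(ℝ, E) x).symm y)) with hfc
  have hsrc := hη.eventually_mem_source h0 x
  have hfcs : ContDiffAt ℝ ∞ fc y₀ := by
    have h1 : ContMDiffAt 𝓘(ℝ, E) 𝓘(ℝ, E) ∞ (extChartAt 𝓘(ℝ, E) x).symm y₀ :=
      (contMDiffOn_extChartAt_symm x).contMDiffAt (extChartAt_target_mem_nhds x)
    refine ContMDiffAt.contDiffAt (ContMDiffAt.comp y₀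
      (g := fun p => φ.toFun p (coordFrame x p)) ?_ h1)
    rw [hy₀, extChartAt_to_inv]
    exact φ.smooth x
  set y : ℝ → E := fun t => extChartAt 𝓘(ℝ, E) x (η t x) with hy
  have hy0 : y 0 = y₀ := by simp only [hy, h0]; rfl
  have hys : ContDiffAt ℝ ∞ y 0 := by
    refine ContMDiffAt.contDiffAt (ContMDiffAt.comp (0 : ℝ) (g := extChartAt 𝓘(ℝ, E) x)
      (f := fun t => η t x) ?_ (hη.contMDiff_apply x).contMDiffAt)
    rw [h0]
    exact contMDiffAt_extChartAt
  set v : ℝ → V := fun t => φ.toFun (η t x) (coordFrame x (η t x)) with hvdef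
  have hvy : v =ᶠ[𝓝 0] fun t => fc (y t) := by
    filter_upwards [hsrc] with t ht
    have : (extChartAt 𝓘(ℝ, E) x).symm (extChartAt 𝓘(ℝ, E) x (η t x)) = η t x :=
      (extChartAt 𝓘(ℝ, E) x).left_inv (by simpa using ht)
    exact congrArg (fun z => φ.toFun z (coordFrame x z)) this.symm
  have hvs : ContDiffAt ℝ ∞ v 0 :=
    ContDiffAt.congr_of_eventuallyEq (ContDiffAt.comp (0 : ℝ) (g := fc) (f := y) (hy0 ▸ hfcs) hys) hvy
  have hv' : deriv v 0 = fderiv ℝ fc y₀ (deriv y 0) := by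
    rw [hvy.deriv_eq, ← hy0]
    refine HasDerivAt.deriv ?_
    exact HasFDerivAt.comp_hasDerivAt (0 : ℝ)
      ((hy0 ▸ hfcs).differentiableAt (by simp)).hasFDerivAt
      (hys.differentiableAt (by simp)).hasDerivAt
  have hA : ContMDiffAt 𝓘(ℝ, ℝ) 𝓘(ℝ, E →L[ℝ] E) ∞ (fun t => frameChange (η t) x x x) 0 := by
    have h1 := frameChange_smooth hη 0 x
    rw [h0] at h1
    exact ContMDiffAt.comp (0 : ℝ) (g := fun r : ℝ × M => frameChange (η r.1) x x r.2)
      (f := fun t : ℝ => (t, x)) h1 (contMDiffAt_id.prodMk contMDiffAt_const)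
  have hA0 : frameChange (η 0) x x x = 1 := by rw [h0, frameChange_refl]
  -- The derivative of `v` gives X^μ ∂_μ φ, that of the inverse Jacobian gives -ρ_*(∂X)φ, and the
  -- constant factor passes from the coordinate frame to `e`.
  have hmain := ρ.hasDerivAt_apply (frameGroupElement e)⁻¹
    (ρ.hasDerivAt_inv_apply hA hA0 (hasDerivAt_frameChange hη h0 x) hvs)
  have hcurve : (fun t => (φ.pull (η t)).toFun x e) = fun t =>
      ρ.toHom (frameGroupElement e)⁻¹ (ρ.toHom (frameChange (η t) x x x)⁻¹ (v t)) := by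
    funext t
    rw [hvdef, ← framePull_coordFrame]
    exact (φ.pull (η t)).apply_frame e
  have hX : (trivializationAt E (TangentSpace 𝓘(ℝ, E)) x
      (diffVelocity η ((extChartAt 𝓘(ℝ, E) x).symm y₀))).2 = deriv y 0 := by
    rw [hy₀, extChartAt_to_inv]
    refine trivializationAt_diffVelocity hη ?_
    rw [h0]
    exact mem_chart_source E x
  have hv0 : v 0 = fc y₀ := by rw [hvy.eq_of_nhds, hy0]
  rw [hv', ← hX, hv0] at hmain
  change deriv (fun t => (φ.pull (η t)).toFun x e) 0 = _
  rw [hcurve, hmain.deriv]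
  rfl

end

/-! ### Vertical vectors, pushforwards and forms -/

section

variable {E : Type*} [NormedAddCommGroup E] [NormedSpace ℝ E] [CompleteSpace E]
  {V : Type*} [NormedAddCommGroup V] [NormedSpace ℝ V]
  {M : Type*} [TopologicalSpace M] [ChartedSpace E M] [IsManifold 𝓘(ℝ, E) ∞ M]
  {ρ : FrameAction E V} {η : ℝ → Diff E M}

theorem IsSmoothDiffCurve.precomp (hη : IsSmoothDiffCurve η) (σ : Diff E M) :
    IsSmoothDiffCurve (fun t => σ.trans (η t)) :=
  ContMDiff.comp (g := fun r : ℝ × M => η r.1 r.2) (f := fun q : ℝ × M => (q.1, σ q.2)) hη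
    (contMDiff_fst.prodMk (σ.contMDiff.comp contMDiff_snd))

theorem IsSmoothDiffCurve.postcomp (hη : IsSmoothDiffCurve η) (σ : Diff E M) :
    IsSmoothDiffCurve (fun t => (η t).trans σ) :=
  σ.contMDiff.comp hη

theorem diffVelocity_postcomp (hη : IsSmoothDiffCurve η) (σ : Diff E M) :
    diffVelocity (fun t => (η t).trans σ) =
      tangentMap 𝓘(ℝ, E) 𝓘(ℝ, E) σ ∘ diffVelocity η := by
  funext x
  have h := mfderiv_comp (I := 𝓘(ℝ, ℝ)) (I' := 𝓘(ℝ, E)) (I'' := 𝓘(ℝ, E)) (0 : ℝ)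
    (f := fun t => η t x) (σ.contMDiff.mdifferentiableAt (by simp))
    ((hη.contMDiff_apply x).mdifferentiableAt (by simp))
  exact congrArg (fun L : ℝ →L[ℝ] TangentSpace 𝓘(ℝ, E) (σ (η 0 x)) =>
    (⟨σ (η 0 x), L 1⟩ : TM E M)) h

/-- With η frozen, pullback is evaluation at a fixed point and frame, so it commutes with the time
derivative by definition. -/
theorem velocity_pull_curve {c : ℝ → Field ρ M} (hc : IsSmoothCurve c)
    (hη : IsSmoothDiffCurve η) :
    velocity (fun t => (c t).pull (η t)) =
      framePull (η 0) (velocity c) + velocity (fun t => (c 0).pull (η t)) := by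
  funext x e
  have h := hasDerivAt_diag (differentiableAt_framePull hc hη (0, 0) x e)
  refine h.deriv.trans ?_
  rw [add_comm]
  rfl

namespace FieldSpace

variable {Φ : FieldSpace ρ M}

/-- Well-definedness of `vert`: the chosen curve may differ from `η`, but the Lie derivative sees
only their common velocity. -/
theorem coe_vert [FiniteDimensional ℝ V] (hη : IsSmoothDiffCurve η)
    (h0 : η 0 = Diffeomorph.refl 𝓘(ℝ, E) M ∞) (φ : Φ.Pt) :
    (vert (diffVelocity η) φ : FrameFun E V M) = lieDeriv ρ (diffVelocity η) φ.1.toFun := by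
  have h : ∃ ζ : ℝ → Diff E M, IsSmoothDiffCurve ζ ∧ ζ 0 = Diffeomorph.refl 𝓘(ℝ, E) M ∞ ∧
      diffVelocity ζ = diffVelocity η := ⟨η, hη, h0, rfl⟩
  have h1 : vert (diffVelocity η) φ =
      (orbitCurve φ h.choose_spec.1 h.choose_spec.2.1).vec := dif_pos h
  rw [h1]
  refine (velocity_pull φ.1 h.choose_spec.1 h.choose_spec.2.1).trans ?_
  rw [h.choose_spec.2.2]

theorem velocity_pull_eq_vert [FiniteDimensional ℝ V] (hη : IsSmoothDiffCurve η)
    (h0 : η 0 = Diffeomorph.refl 𝓘(ℝ, E) M ∞) (φ : Φ.Pt) :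
    velocity (fun t => φ.1.pull (η t)) = vert (diffVelocity η) φ := by
  rw [velocity_pull φ.1 hη h0, coe_vert hη h0]

/-- Factor η_t = (η_t ∘ η_0⁻¹) ∘ η_0; the curve in brackets starts at the identity and acts on φ
first. -/
theorem velocity_pull_eq_framePull_vert [FiniteDimensional ℝ V] (hη : IsSmoothDiffCurve η)
    (φ : Φ.Pt) :
    velocity (fun t => φ.1.pull (η t)) =
      framePull (η 0) (vert (diffVelocity η ∘ (η 0).symm) φ : FrameFun E V M) := by
  have h := velocity_pull_eq_vert (hη.precomp (η 0).symm) (η 0).symm_trans_self φ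
  have h1 : diffVelocity (fun t => (η 0).symm.trans (η t)) = diffVelocity η ∘ (η 0).symm := rfl
  have h2 : (fun t => (φ.1.pull (η t)).toFun) =
      fun t => framePull (η 0) (φ.1.pull ((η 0).symm.trans (η t))).toFun := by
    funext t
    change framePull (η t) _ = framePull (η 0) (framePull ((η 0).symm.trans (η t)) _)
    rw [← framePull_trans]
    congr 2
    exact Diffeomorph.ext fun x => (congrArg (η t) ((η 0).symm_apply_apply x)).symm
  rw [← h1, ← h]
  funext x e
  exact congrArg (fun f : ℝ → FrameFun E V M => deriv (fun t => f t x e) 0) h2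

/-- Factor η_t = η_0 ∘ (η_0⁻¹ ∘ η_t); now η_0 acts first, and the remaining curve moves η_0^* φ. -/
theorem velocity_pull_eq_vert_pull [FiniteDimensional ℝ V] (hη : IsSmoothDiffCurve η)
    (φ : Φ.Pt) :
    velocity (fun t => φ.1.pull (η t)) =
      vert (tangentMap 𝓘(ℝ, E) 𝓘(ℝ, E) (η 0).symm ∘ diffVelocity η) (Φ.R (η 0) φ) := by
  have h := velocity_pull_eq_vert (hη.postcomp (η 0).symm) (η 0).self_trans_symm (Φ.R (η 0) φ)
  rw [← diffVelocity_postcomp hη, ← h]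
  congr 1
  funext t
  refine Field.ext ?_
  change framePull (η t) _ = framePull ((η t).trans (η 0).symm) (framePull (η 0) _)
  rw [← framePull_trans]
  congr 2
  exact Diffeomorph.ext fun x => ((η 0).apply_symm_apply (η t x)).symm

theorem coe_vert_symm_comp [FiniteDimensional ℝ V]
    (hη : IsSmoothDiffCurve η) (φ : Φ.Pt) :
    (vert (diffVelocity η ∘ (η 0).symm) φ : FrameFun E V M) =
      lieDeriv ρ (diffVelocity η ∘ (η 0).symm) φ.1.toFun :=
  coe_vert (hη.precomp (η 0).symm) (η 0).symm_trans_self φ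

section Push

variable {F : Φ.Pt → Φ.Pt} {ψ : Φ.Pt → Diff E M}

/-- `F φ` and `Φ.R (ψ φ) φ` are only propositionally equal, so their tangent spaces are different
types; vectors are compared as functions on LM. -/
theorem coe_push_eq_velocity (hF : Φ.SmoothMap F) (h : ∀ φ, F φ = Φ.R (ψ φ) φ)
    {φ : Φ.Pt} (c : CurveAt φ) :
    (push hF c : FrameFun E V M) =
      velocity (fun t => (c.toFun t).1.pull (ψ (c.toFun t))) :=
  congrArg velocity (funext fun t => congrArg Subtype.val (h (c.toFun t)))

theorem coe_push_eq_add_vert [FiniteDimensional ℝ V] (hF : Φ.SmoothMap F)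
    (hψ : Φ.SmoothGenerating ψ) (h : ∀ φ, F φ = Φ.R (ψ φ) φ) {φ : Φ.Pt} (c : CurveAt φ) :
    (push hF c : FrameFun E V M) = Rpush (ψ φ) φ c.vec +
      vert (tangentMap 𝓘(ℝ, E) 𝓘(ℝ, E) (ψ φ).symm ∘ dGen ψ c) (F φ) := by
  rw [coe_push_eq_velocity hF h, velocity_pull_curve c.smooth (hψ _ c.smooth),
    velocity_pull_eq_vert_pull (hψ _ c.smooth), ← h, c.zero]
  rfl

theorem coe_push_eq_Rpush [FiniteDimensional ℝ V] (hF : Φ.SmoothMap F)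
    (hψ : Φ.SmoothGenerating ψ) (h : ∀ φ, F φ = Φ.R (ψ φ) φ) {φ : Φ.Pt} (c : CurveAt φ) :
    (push hF c : FrameFun E V M) =
      Rpush (ψ φ) φ (c.vec + vert (dGen ψ c ∘ (ψ φ).symm) φ) := by
  rw [coe_push_eq_velocity hF h, velocity_pull_curve c.smooth (hψ _ c.smooth),
    velocity_pull_eq_framePull_vert (hψ _ c.smooth), c.zero, map_add]
  rfl

end Push

variable {k : ℕ} {W : Type*} [AddCommGroup W] [Module ℝ W]

theorem Form.congr_point (α : Form Φ k W) {φ φ' : Φ.Pt} (h : φ = φ') {v : Fin k → Tan φ}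
    {v' : Fin k → Tan φ'} (hv : ∀ i, (v i : FrameFun E V M) = v' i) : α φ v = α φ' v' := by
  subst h
  exact congrArg (α φ) (funext fun i => Subtype.ext (hv i))

theorem Form.pullback_eq_pullR [FiniteDimensional ℝ V] (α : Form Φ k W) {F : Φ.Pt → Φ.Pt}
    {ψ : Φ.Pt → Diff E M} (hF : Φ.SmoothMap F) (hψ : Φ.SmoothGenerating ψ)
    (h : ∀ φ, F φ = Φ.R (ψ φ) φ) {φ : Φ.Pt} (c : Fin k → CurveAt φ) :
    α.pullback hF c =
      α.pullR (ψ φ) φ (fun i => (c i).vec + vert (dGen ψ (c i) ∘ (ψ φ).symm) φ) :=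
  α.congr_point (h φ) fun i => coe_push_eq_Rpush hF hψ h (c i)

/-- Expand by multilinearity over the subsets s of slots that keep `v`. Every s other than the full
set leaves a vertical vector in some slot, so only the term α(v) survives. -/
theorem Form.IsHorizontal.apply_add_vert {α : Form Φ k W} (hα : α.IsHorizontal) (φ : Φ.Pt)
    (v : Fin k → Tan φ) (X : Fin k → M → TM E M) :
    α φ (fun i => v i + vert (X i) φ) = α φ v := by
  have h := (α φ).toMultilinearMap.map_add_univ v (fun i => vert (X i) φ)
  refine h.trans ((Finset.sum_eq_single Finset.univ (fun s _ hs => ?_) (by simp)).trans ?_)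
  · obtain ⟨i, hi⟩ : ∃ i, i ∉ s := by
      simpa [Finset.eq_univ_iff_forall] using hs
    exact hα φ (X i) _ i (Finset.piecewise_eq_of_notMem s _ _ hi)
  · rw [Finset.piecewise_univ]
    rfl

end FieldSpace

end

end FieldSpaceGeometry

open FieldSpaceGeometry FieldSpaceGeometry.FieldSpace in
theorem mainTheorem4 {n : ℕ} {M : Type*} [TopologicalSpace M]
    [ChartedSpace (EuclideanSpace ℝ (Fin n)) M]
    [IsManifold 𝓘(ℝ, EuclideanSpace ℝ (Fin n)) ∞ M]
    {V : Type*} [NormedAddCommGroup V] [NormedSpace ℝ V] [FiniteDimensional ℝ V]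
    (ρ : FrameAction (EuclideanSpace ℝ (Fin n)) V) (Φ : FieldSpace ρ M)
    (Ξ : Φ.VerticalDiffeo)
    (ψ : Φ.Pt → Diff (EuclideanSpace ℝ (Fin n)) M) (hψ : Φ.SmoothGenerating ψ)
    (hΞ : ∀ φ, Ξ.toFun φ = Φ.R (ψ φ) φ) :
    -- pushforward by `Ξ` of the tangent vector of any smooth curve `c` in `Φ` through `φ`:
    -- `Ξ_⋆ 𝔛 = R_{ψ(φ)⋆} 𝔛 + {ψ(φ)⁻¹_* dψ(𝔛)}^v = R_{ψ(φ)⋆} (𝔛 + {dψ(𝔛) ∘ ψ(φ)⁻¹}^v)`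
    (∀ (φ : Φ.Pt) (c : CurveAt φ),
      (push Ξ.smooth_toFun c : FrameFun (EuclideanSpace ℝ (Fin n)) V M) =
          Rpush (ψ φ) φ c.vec +
            vert (tangentMap 𝓘(ℝ, EuclideanSpace ℝ (Fin n)) 𝓘(ℝ, EuclideanSpace ℝ (Fin n))
              (ψ φ).symm ∘ dGen ψ c) (Ξ.toFun φ) ∧
      (push Ξ.smooth_toFun c : FrameFun (EuclideanSpace ℝ (Fin n)) V M) =
          Rpush (ψ φ) φ (c.vec + vert (dGen ψ c ∘ (ψ φ).symm) φ)) ∧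
    -- the vertical transformation `α^ψ = Ξ^⋆ α` of a form:
    -- `α^ψ(𝔛₁, …) = (R_{ψ(φ)}^⋆ α)(𝔛₁ + {dψ(𝔛₁) ∘ ψ(φ)⁻¹}^v, …)`
    (∀ (k : ℕ) (W : Type*) [AddCommGroup W] [Module ℝ W] (α : Form Φ k W) (φ : Φ.Pt)
      (c : Fin k → CurveAt φ),
      α.pullback Ξ.smooth_toFun c =
        α.pullR (ψ φ) φ (fun i => (c i).vec + vert (dGen ψ (c i) ∘ (ψ φ).symm) φ)) ∧
    -- for tensorial forms, twisted by a cocycle: `α^ψ = C(φ; ψ(φ))⁻¹ α`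
    (∀ (k : ℕ) (W : Type*) [AddCommGroup W] [Module ℝ W] (G : Type*) [Group G]
      [DistribMulAction G W] (C : Φ.Pt → Diff (EuclideanSpace ℝ (Fin n)) M → G)
      (α : Form Φ k W), IsCocycle C → α.IsEquivariant C → α.IsHorizontal →
      ∀ (φ : Φ.Pt) (c : Fin k → CurveAt φ),
        α.pullback Ξ.smooth_toFun c = (C φ (ψ φ))⁻¹ • α φ (fun i => (c i).vec)) ∧
    -- the basis `1`-form: `dφ^ψ = ψ^* (dφ + 𝔏_{dψ ∘ ψ⁻¹} φ)`
    (∀ (φ : Φ.Pt) (c : CurveAt φ),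
      (basisForm Φ).pullback Ξ.smooth_toFun (fun _ => c) =
        framePull (ψ φ) (basisForm Φ φ (fun _ => c.vec) +
          lieDeriv ρ (dGen ψ c ∘ (ψ φ).symm) φ.1.toFun)) := by
  refine ⟨fun φ c => ⟨coe_push_eq_add_vert _ hψ hΞ c, coe_push_eq_Rpush _ hψ hΞ c⟩,
    fun k W _ _ α φ c => α.pullback_eq_pullR _ hψ hΞ c, ?_, fun φ c => ?_⟩
  · intro k W _ _ G _ _ C α _ hα hα' φ c
    -- Equivariance is a statement about fixed diffeomorphisms: all variation of ψ has moved into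
    -- the vertical arguments, so it applies to the single element ψ(φ).
    rw [α.pullback_eq_pullR _ hψ hΞ c, hα, hα'.apply_add_vert]
  · refine (coe_push_eq_Rpush _ hψ hΞ c).trans ?_
    have h := coe_vert_symm_comp (hψ _ c.smooth) φ
    rw [c.zero] at h
    exact congrArg (fun f => framePull (ψ φ) ((c.vec : FrameFun _ V M) + f)) h
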